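/- Let $M$ be a smooth manifold (Hausdorff, paracompact, finite-dimensional, without boundary) and let $E\to M$ be a smooth real vector bundle with a Lie algebroid structure: a smooth vector bundle map $\rho_E:E\to TM$ and a real Lie bracket $[\cdot,\cdot]_E$ on the space $\Gamma(E)$ of smooth sections such that $[s_1,fs_2]_E=f[s_1,s_2]_E+\rho_E(s_1)(f)\,s_2$ for all $s_1,s_2\in\Gamma(E)$, $f\in C^\infty(M)$. For a smooth section $\eta$ of $E^*$, let $d_E\eta$ be the $2$-form given by $$2\,d_E\eta(s_1,s_2)=\rho_E(s_1)(\eta(s_2))-\rho_E(s_2)(\eta(s_1))-\eta([s_1,s_2]_E).$$ An almost contact Riemannian structure on $E$ is a quadruple $(F_E,\xi,\eta,g_E)$ consisting of smooth sections $F_E$ of $\mathrm{End}(E)$, $\xi$ of $E$ and $\eta$ of $E^*$, and a smooth Riemannian bundle metric $g_E$ on $E$, such that $$F_E^2=-I_E+\eta\otimes\xi,\qquad \eta(\xi)=1,\qquad g_E(F_E(s_1),F_E(s_2))=g_E(s_1,s_2)-\eta(s_1)\eta(s_2).$$ If $\operatorname{rank}E=2m+1$, then $E$ with such a structure is called * a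 contact Riemannian Lie algebroid if $\eta\wedge(d_E\eta)^m\neq 0$ at every point of $M$ and $d_E\eta(s_1,s_2)=g_E(s_1,F_E(s_2))$ for all $s_1,s_2\in\Gamma(E)$; * $K$-contact if it is contact Riemannian and $\xi$ is a Killing section, that is, $\mathcal L_\xi g_E=0$, where $(\mathcal L_\xi g_E)(s_1,s_2)=\rho_E(\xi)(g_E(s_1,s_2))-g_E([\xi,s_1]_E,s_2)-g_E(s_1,[\xi,s_2]_E)$; * Sasakian if it is contact Riemannian and normal, that is, $N_{F_E}+2\,d_E\eta\otimes\xi=0$, where $N_{F_E}(s_1,s_2)=[F_E(s_1),F_E(s_2)]_E-F_E([F_E(s_1),s_2]_E)-F_E([s_1,F_E(s_2)]_E)+F_E^2([s_1,s_2]_E)$. **Proposition.** Every $K$-contact Lie algebroid of rank $3$ is Sasakian. -/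

import Mathlib

open scoped Manifold ContDiff Bundle

noncomputable section

section LieAlgebroids

/-- The space `Γ(E)` of smooth global sections of a smooth vector bundle `E → M` (with model fibre
`F`) over an `n`-dimensional manifold `M`. -/
abbrev SmoothSec (n : ℕ) {M : Type*} [TopologicalSpace M]
    [ChartedSpace (EuclideanSpace ℝ (Fin n)) M]
    (F : Type*) [NormedAddCommGroup F] [NormedSpace ℝ F]
    (E : M → Type*) [TopologicalSpace (Bundle.TotalSpace F E)] [∀ x, TopologicalSpace (E x)]
    [FiberBundle F E] :=
  ContMDiffSection (𝓡 n) F ∞ E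

variable {n : ℕ} {M : Type*} [TopologicalSpace M] [ChartedSpace (EuclideanSpace ℝ (Fin n)) M]
  [IsManifold (𝓡 n) ∞ M]
  {F : Type*} [NormedAddCommGroup F] [NormedSpace ℝ F]
  {E : M → Type*} [TopologicalSpace (Bundle.TotalSpace F E)]
  [∀ x, AddCommGroup (E x)] [∀ x, Module ℝ (E x)] [∀ x, TopologicalSpace (E x)]
  [∀ x, IsTopologicalAddGroup (E x)] [∀ x, ContinuousSMul ℝ (E x)]
  [FiberBundle F E] [VectorBundle ℝ F E] [ContMDiffVectorBundle ∞ F E (𝓡 n)]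

/-- The product `f • s` of a smooth function and a smooth section. -/
def SmoothSec.funSMul (f : C^∞⟮𝓡 n, M; ℝ⟯) (s : SmoothSec n F E) : SmoothSec n F E where
  toFun x := f x • s x
  contMDiff_toFun := ContMDiff.smul_section f.contMDiff s.contMDiff

/-- The action `s ↦ A s` on sections of a smooth `(1,1)`-tensor, that is, of a smooth section `A`
of the bundle `End E`. -/
def SmoothSec.applyEnd (A : SmoothSec n (F →L[ℝ] F) (fun x => E x →L[ℝ] E x))
    (s : SmoothSec n F E) : SmoothSec n F E where
  toFun x := A x (s x)
  contMDiff_toFun := ContMDiff.clm_bundle_apply A.contMDiff s.contMDiff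

/-- The derivative `v(f)` of a real function `f` on `M` along a tangent vector `v` at `x`. -/
def tangentDeriv {n : ℕ} {M : Type*} [TopologicalSpace M]
    [ChartedSpace (EuclideanSpace ℝ (Fin n)) M] (f : M → ℝ) (x : M)
    (v : TangentSpace (𝓡 n) x) : ℝ :=
  mfderiv (𝓡 n) 𝓘(ℝ, ℝ) f x v

/-- A Lie algebroid structure on the smooth vector bundle `E → M`: an anchor, which is a smooth
vector bundle map `ρ : E → TM` (a smooth section of `Hom(E, TM)`), and a real Lie bracket on `Γ(E)`
such that `[s, f t] = f [s, t] + ρ(s)(f) t`. -/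
structure LieAlgebroid (n : ℕ) {M : Type*} [TopologicalSpace M]
    [ChartedSpace (EuclideanSpace ℝ (Fin n)) M] [IsManifold (𝓡 n) ∞ M]
    (F : Type*) [NormedAddCommGroup F] [NormedSpace ℝ F]
    (E : M → Type*) [TopologicalSpace (Bundle.TotalSpace F E)]
    [∀ x, AddCommGroup (E x)] [∀ x, Module ℝ (E x)] [∀ x, TopologicalSpace (E x)]
    [∀ x, IsTopologicalAddGroup (E x)] [∀ x, ContinuousSMul ℝ (E x)]
    [FiberBundle F E] [VectorBundle ℝ F E] [ContMDiffVectorBundle ∞ F E (𝓡 n)] where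
  /-- The anchor `ρ : E → TM`. -/
  anchor : SmoothSec n (F →L[ℝ] EuclideanSpace ℝ (Fin n))
    (fun x : M => E x →L[ℝ] TangentSpace (𝓡 n) x)
  /-- The bracket of sections. -/
  bracket : SmoothSec n F E →ₗ[ℝ] SmoothSec n F E →ₗ[ℝ] SmoothSec n F E
  bracket_self : ∀ s, bracket s s = 0
  jacobi : ∀ s t u,
    bracket s (bracket t u) + bracket t (bracket u s) + bracket u (bracket s t) = 0
  leibniz : ∀ (s t : SmoothSec n F E) (f : C^∞⟮𝓡 n, M; ℝ⟯) (x : M),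
    bracket s (SmoothSec.funSMul f t) x =
      f x • bracket s t x + tangentDeriv f x (anchor x (s x)) • t x

namespace LieAlgebroid

variable (A : LieAlgebroid n F E)

/-- The derivative `ρ(s)(f)` of a real function on the base along the anchor of a section. -/
def deriv (s : SmoothSec n F E) (f : M → ℝ) (x : M) : ℝ :=
  tangentDeriv f x (A.anchor x (s x))

/-- The exterior derivative of a `1`-form on the Lie algebroid, in the normalization
`2 dη(s, t) = ρ(s)(η(t)) - ρ(t)(η(s)) - η([s, t])`. -/
def extDeriv (η : SmoothSec n (F →L[ℝ] ℝ) (fun x => E x →L[ℝ] ℝ)) (s t : SmoothSec n F E)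
    (x : M) : ℝ :=
  (A.deriv s (fun y => η y (t y)) x - A.deriv t (fun y => η y (s y)) x - η x (A.bracket s t x)) / 2

/-- Up to a nonzero constant depending only on `m`, the function
`(η ∧ (dη)^m)(s₀, …, s₂ₘ)` on the base: the complete antisymmetrization of `η ⊗ (dη)^{⊗ m}`. -/
def wedgeContact (η : SmoothSec n (F →L[ℝ] ℝ) (fun x => E x →L[ℝ] ℝ)) (m : ℕ)
    (s : Fin (2 * m + 1) → SmoothSec n F E) (x : M) : ℝ :=
  ∑ σ : Equiv.Perm (Fin (2 * m + 1)), ((Equiv.Perm.sign σ : ℤ) : ℝ) *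
    (η x (s (σ 0) x) * ∏ i : Fin m,
      A.extDeriv η (s (σ ⟨2 * i + 1, by omega⟩)) (s (σ ⟨2 * i + 2, by omega⟩)) x)

/-- `η` is a contact form: the rank is `2m + 1` and `η ∧ (dη)^m` vanishes nowhere on `M`. -/
def IsContactForm (η : SmoothSec n (F →L[ℝ] ℝ) (fun x => E x →L[ℝ] ℝ)) : Prop :=
  ∃ m : ℕ, Module.finrank ℝ F = 2 * m + 1 ∧
    ∀ x : M, ∃ s : Fin (2 * m + 1) → SmoothSec n F E, A.wedgeContact η m s x ≠ 0

/-- The Nijenhuis tensor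
`N_Φ(s, t) = [Φ s, Φ t] - Φ [Φ s, t] - Φ [s, Φ t] + Φ² [s, t]` of a `(1,1)`-tensor `Φ`. -/
def nijenhuis (Φ : SmoothSec n (F →L[ℝ] F) (fun x => E x →L[ℝ] E x))
    (s t : SmoothSec n F E) : SmoothSec n F E :=
  A.bracket (Φ.applyEnd s) (Φ.applyEnd t) - Φ.applyEnd (A.bracket (Φ.applyEnd s) t)
    - Φ.applyEnd (A.bracket s (Φ.applyEnd t)) + Φ.applyEnd (Φ.applyEnd (A.bracket s t))

/-- `ξ` is a Killing section of the metric `g`: the Lie derivative `L_ξ g` vanishes. -/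
def IsKilling (ξ : SmoothSec n F E) (g : Bundle.ContMDiffRiemannianMetric (𝓡 n) ∞ F E) : Prop :=
  ∀ (s t : SmoothSec n F E) (x : M),
    A.deriv ξ (fun y => g.inner y (s y) (t y)) x
      - g.inner x (A.bracket ξ s x) (t x) - g.inner x (s x) (A.bracket ξ t x) = 0

end LieAlgebroid

/-- An almost contact Riemannian structure `(Φ, ξ, η, g)` on the vector bundle `E`:
`Φ² = -I + η ⊗ ξ`, `η(ξ) = 1` and `g(Φ s, Φ t) = g(s, t) - η(s) η(t)`. -/
structure AlmostContactRiemannian (n : ℕ) {M : Type*} [TopologicalSpace M]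
    [ChartedSpace (EuclideanSpace ℝ (Fin n)) M]
    (F : Type*) [NormedAddCommGroup F] [NormedSpace ℝ F]
    (E : M → Type*) [TopologicalSpace (Bundle.TotalSpace F E)]
    [∀ x, AddCommGroup (E x)] [∀ x, Module ℝ (E x)] [∀ x, TopologicalSpace (E x)]
    [∀ x, IsTopologicalAddGroup (E x)] [∀ x, ContinuousSMul ℝ (E x)]
    [FiberBundle F E] [VectorBundle ℝ F E] where
  /-- The structure endomorphism. -/
  Φ : SmoothSec n (F →L[ℝ] F) (fun x => E x →L[ℝ] E x)
  /-- The Reeb section. -/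
  ξ : SmoothSec n F E
  /-- The `1`-form. -/
  η : SmoothSec n (F →L[ℝ] ℝ) (fun x => E x →L[ℝ] ℝ)
  /-- The Riemannian metric on the bundle. -/
  g : Bundle.ContMDiffRiemannianMetric (𝓡 n) ∞ F E
  Φ_sq : ∀ (x : M) (v : E x), Φ x (Φ x v) = -v + η x v • ξ x
  η_ξ : ∀ x : M, η x (ξ x) = 1
  compat : ∀ (x : M) (v w : E x),
    g.inner x (Φ x v) (Φ x w) = g.inner x v w - η x v * η x w

namespace LieAlgebroid

variable (A : LieAlgebroid n F E) (S : AlmostContactRiemannian n F E)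

/-- The Lie algebroid `A` with the structure `(Φ, ξ, η, g)` is a contact Riemannian Lie algebroid:
`η` is a contact form and `dη` is the fundamental `2`-form `Ω(s, t) = g(s, Φ t)`. -/
def IsContactRiemannian : Prop :=
  A.IsContactForm S.η ∧
    ∀ (s t : SmoothSec n F E) (x : M), A.extDeriv S.η s t x = S.g.inner x (s x) (S.Φ x (t x))

/-- A `K`-contact Lie algebroid: contact Riemannian, with Killing Reeb section. -/
def IsKContact : Prop :=
  A.IsContactRiemannian S ∧ A.IsKilling S.ξ S.g

/-- Normality: `N_Φ + 2 dη ⊗ ξ = 0`. -/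
def IsNormal : Prop :=
  ∀ (s t : SmoothSec n F E) (x : M),
    A.nijenhuis S.Φ s t x + (2 * A.extDeriv S.η s t x) • S.ξ x = 0

/-- A Sasakian Lie algebroid: contact Riemannian and normal. -/
def IsSasakian : Prop :=
  A.IsContactRiemannian S ∧ A.IsNormal S

end LieAlgebroid

end LieAlgebroids

end

/-! Since `η(ξ) = 1` and `Φ ξ = 0`, the Reeb section preserves `dη = g(·, Φ ·)`; being Killing it
also preserves `g`, hence `Φ` (`IsKContact.bracket_ξ_applyEnd`). So the tensor `N = N_Φ + 2 dη ⊗ ξ`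
vanishes on `(ξ, t)`. For horizontal `u` the definitions give `N(u, Φ u) = 0`
(`normality_applyEnd`). In rank 3, `ξ, u, Φ u` span each fibre where `u ≠ 0`, and `N` is skew and
`C^∞(M)`-linear, so `N = 0`. Only global sections are used: the contact condition supplies `u`
nonzero at the given point, and expansions are multiplied by `g(u, u)` so that their coefficients
are smooth even where `u` vanishes. -/

noncomputable section

set_option linter.unusedSectionVars false

variable {n : ℕ} {M : Type*} [TopologicalSpace M] [ChartedSpace (EuclideanSpace ℝ (Fin n)) M]
  [IsManifold (𝓡 n) ∞ M]
  {F : Type*} [NormedAddCommGroup F] [NormedSpace ℝ F]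
  {E : M → Type*} [TopologicalSpace (Bundle.TotalSpace F E)]
  [∀ x, AddCommGroup (E x)] [∀ x, Module ℝ (E x)] [∀ x, TopologicalSpace (E x)]
  [∀ x, IsTopologicalAddGroup (E x)] [∀ x, ContinuousSMul ℝ (E x)]
  [FiberBundle F E] [VectorBundle ℝ F E] [ContMDiffVectorBundle ∞ F E (𝓡 n)]

/-! ### Smooth functions and sections built from tensors. -/

namespace SmoothSec

/-- The smooth function `η(s)`. -/
def pairing (η : SmoothSec n (F →L[ℝ] ℝ) (fun x => E x →L[ℝ] ℝ)) (s : SmoothSec n F E) :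
    C^∞⟮𝓡 n, M; ℝ⟯ :=
  ⟨fun x => η x (s x), by
    have h : ContMDiff (𝓡 n) ((𝓡 n).prod 𝓘(ℝ, ℝ)) ∞
        (fun x => Bundle.TotalSpace.mk' ℝ (E := Bundle.Trivial M ℝ) x (η x (s x))) :=
      ContMDiff.clm_bundle_apply η.contMDiff s.contMDiff
    intro x
    exact (Bundle.contMDiffAt_totalSpace.1 (h x)).2⟩

/-- The smooth function `g(s, t)`. -/
def inner (g : Bundle.ContMDiffRiemannianMetric (𝓡 n) ∞ F E) (s t : SmoothSec n F E) :
    C^∞⟮𝓡 n, M; ℝ⟯ :=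
  ⟨fun x => g.inner x (s x) (t x), by
    have h : ContMDiff (𝓡 n) ((𝓡 n).prod 𝓘(ℝ, ℝ)) ∞
        (fun x => Bundle.TotalSpace.mk' ℝ (E := Bundle.Trivial M ℝ) x
          (g.inner x (s x) (t x))) :=
      ContMDiff.clm_bundle_apply₂ g.contMDiff s.contMDiff t.contMDiff
    intro x
    exact (Bundle.contMDiffAt_totalSpace.1 (h x)).2⟩

@[simp]
theorem pairing_apply (η : SmoothSec n (F →L[ℝ] ℝ) (fun x => E x →L[ℝ] ℝ))
    (s : SmoothSec n F E) (x : M) : pairing η s x = η x (s x) := rfl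

@[simp]
theorem inner_apply (g : Bundle.ContMDiffRiemannianMetric (𝓡 n) ∞ F E)
    (s t : SmoothSec n F E) (x : M) : inner g s t x = g.inner x (s x) (t x) := rfl

@[simp]
theorem funSMul_apply (f : C^∞⟮𝓡 n, M; ℝ⟯) (s : SmoothSec n F E) (x : M) :
    funSMul f s x = f x • s x := rfl

@[simp]
theorem applyEnd_apply (Φ : SmoothSec n (F →L[ℝ] F) (fun x => E x →L[ℝ] E x))
    (s : SmoothSec n F E) (x : M) : applyEnd Φ s x = Φ x (s x) := rfl

@[simp]
protected theorem add_apply (s t : SmoothSec n F E) (x : M) : (s + t) x = s x + t x := rfl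

@[simp]
protected theorem sub_apply (s t : SmoothSec n F E) (x : M) : (s - t) x = s x - t x := rfl

@[simp]
protected theorem neg_apply (s : SmoothSec n F E) (x : M) : (-s) x = -s x := rfl

@[simp]
protected theorem zero_apply (x : M) : (0 : SmoothSec n F E) x = 0 := rfl

theorem add_funSMul (f h : C^∞⟮𝓡 n, M; ℝ⟯) (s : SmoothSec n F E) :
    funSMul (f + h) s = funSMul f s + funSMul h s := by
  ext x
  exact add_smul _ _ _

theorem smul_funSMul (c : ℝ) (f : C^∞⟮𝓡 n, M; ℝ⟯) (s : SmoothSec n F E) :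
    funSMul (c • f) s = c • funSMul f s := by
  ext x
  exact smul_assoc c (f x) (s x)

theorem applyEnd_funSMul (Φ : SmoothSec n (F →L[ℝ] F) (fun x => E x →L[ℝ] E x))
    (f : C^∞⟮𝓡 n, M; ℝ⟯) (s : SmoothSec n F E) :
    applyEnd Φ (funSMul f s) = funSMul f (applyEnd Φ s) := by
  ext x
  exact (Φ x).map_smul _ _

end SmoothSec

open SmoothSec

/-! ### Pointwise algebra of `(Φ, ξ, η, g)`. -/

namespace AlmostContactRiemannian

variable (S : AlmostContactRiemannian n F E) (x : M)

theorem Φ_ξ : S.Φ x (S.ξ x) = 0 := by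
  have h2 : S.Φ x (S.Φ x (S.ξ x)) = 0 := by
    rw [S.Φ_sq, S.η_ξ, one_smul, neg_add_cancel]
  -- As `Φ³ ξ = 0`, this makes `Φ ξ` a multiple `c ξ`; then `Φ² ξ = c² ξ = 0` forces `c = 0`.
  have h3 := S.Φ_sq x (S.Φ x (S.ξ x))
  rw [h2, map_zero] at h3
  obtain ⟨c, hc⟩ : ∃ c : ℝ, S.Φ x (S.ξ x) = c • S.ξ x :=
    ⟨_, (neg_add_eq_zero.1 h3.symm)⟩
  rw [hc, map_smul, hc, smul_smul] at h2
  have h4 := congrArg (S.η x) h2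
  rw [map_smul, S.η_ξ, map_zero, smul_eq_mul, mul_one] at h4
  rw [hc, mul_self_eq_zero.1 h4, zero_smul]

theorem η_Φ (v : E x) : S.η x (S.Φ x v) = 0 := by
  have h := S.Φ_sq x (S.Φ x v)
  rw [S.Φ_sq x v, map_add, map_smul, S.Φ_ξ, smul_zero, add_zero, map_neg] at h
  have h1 : S.η x (S.Φ x v) • S.ξ x = 0 := left_eq_add.1 h
  have h2 := congrArg (S.η x) h1
  rwa [map_smul, S.η_ξ, map_zero, smul_eq_mul, mul_one] at h2

theorem inner_ξ (v : E x) : S.g.inner x v (S.ξ x) = S.η x v := by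
  have h := S.compat x v (S.ξ x)
  rw [S.Φ_ξ, map_zero, S.η_ξ] at h
  linarith

theorem inner_Φ_right (v w : E x) : S.g.inner x v (S.Φ x w) = -S.g.inner x (S.Φ x v) w := by
  have h := S.compat x v (S.Φ x w)
  rw [S.η_Φ, S.Φ_sq, map_add, map_smul, S.inner_ξ, S.η_Φ, map_neg] at h
  simp at h
  linarith

theorem inner_Φ_self (v : E x) : S.g.inner x v (S.Φ x v) = 0 := by
  have h := S.inner_Φ_right x v v
  rw [S.g.symm x (S.Φ x v) v] at h
  linarith

theorem inner_self_eq_zero {v : E x} (h : S.g.inner x v v = 0) : v = 0 := by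
  by_contra hv
  exact (S.g.pos x v hv).ne' h

/-- In rank `3`, a horizontal vector `u`, its image `Φ u` and the Reeb vector span the fibre. -/
theorem inner_self_smul_eq (hrank : Module.finrank ℝ F = 3) {u : E x} (hu : S.η x u = 0)
    (v : E x) :
    S.g.inner x u u • v = S.g.inner x u v • u + S.g.inner x (S.Φ x u) v • S.Φ x u
      + (S.g.inner x u u * S.η x v) • S.ξ x := by
  by_cases hu0 : u = 0
  · simp [hu0]
  rw [← sub_eq_zero]
  set w := S.g.inner x u u • v - (S.g.inner x u v • u + S.g.inner x (S.Φ x u) v • S.Φ x u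
      + (S.g.inner x u u * S.η x v) • S.ξ x) with hw
  have hΦu : S.g.inner x (S.Φ x u) (S.Φ x u) = S.g.inner x u u := by
    rw [S.compat, hu]; ring
  have huξ : S.g.inner x u (S.ξ x) = 0 := by rw [S.inner_ξ, hu]
  have hΦuξ : S.g.inner x (S.Φ x u) (S.ξ x) = 0 := by rw [S.inner_ξ, S.η_Φ]
  have hΦuu : S.g.inner x (S.Φ x u) u = 0 := by rw [S.g.symm, S.inner_Φ_self]
  have hξξ : S.g.inner x (S.ξ x) (S.ξ x) = 1 := by rw [S.inner_ξ, S.η_ξ]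
  have hξv : S.g.inner x (S.ξ x) v = S.η x v := by rw [S.g.symm, S.inner_ξ]
  have hξu : S.g.inner x (S.ξ x) u = 0 := by rw [S.g.symm, huξ]
  have hξΦu : S.g.inner x (S.ξ x) (S.Φ x u) = 0 := by rw [S.g.symm, hΦuξ]
  have hwu : S.g.inner x u w = 0 := by
    simp [hw, S.inner_Φ_self, huξ]; ring
  have hwΦu : S.g.inner x (S.Φ x u) w = 0 := by
    simp [hw, hΦu, hΦuu, hΦuξ]; ring
  have hwξ : S.g.inner x (S.ξ x) w = 0 := by
    simp [hw, hξξ, hξv, hξu, hξΦu]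
  -- Otherwise `ξ, u, Φ u, w` are four nonzero pairwise orthogonal vectors in a 3-dimensional fibre.
  by_contra hw0
  let B : LinearMap.BilinForm ℝ (E x) :=
    LinearMap.mk₂ ℝ (fun a b => S.g.inner x a b) (by simp) (by simp) (by simp) (by simp)
  have hB : ∀ a b, B a b = S.g.inner x a b := fun _ _ => rfl
  have hli : LinearIndependent ℝ ![S.ξ x, u, S.Φ x u, w] := by
    apply LinearMap.BilinForm.linearIndependent_of_iIsOrtho (B := B)
    · intro i j hij
      have hwu' := hwu
      have hwΦu' := hwΦu
      have hwξ' := hwξ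
      rw [S.g.symm] at hwu' hwΦu' hwξ'
      have huΦu := S.inner_Φ_self x u
      fin_cases i <;> fin_cases j <;> first
        | exact absurd rfl hij
        | exact hξu
        | exact hξΦu
        | exact huξ
        | exact hΦuξ
        | exact hΦuu
        | exact huΦu
        | exact hwu
        | exact hwΦu
        | exact hwξ
        | exact hwu'
        | exact hwΦu'
        | exact hwξ'
    · intro i
      have h1 := S.g.pos x u hu0
      have h2 := S.g.pos x w hw0
      fin_cases i
      · simp [hB, hξξ]
      · exact h1.ne'
      · exact (hΦu.trans_ne h1.ne')
      · exact h2.ne'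
  let e : E x ≃L[ℝ] F := Bundle.Trivialization.continuousLinearEquivAt ℝ
    (trivializationAt F E x) x (FiberBundle.mem_baseSet_trivializationAt' x)
  have hfr : Module.finrank ℝ (E x) = 3 := e.toLinearEquiv.finrank_eq.trans hrank
  have : Module.Finite ℝ (E x) := Module.finite_of_finrank_pos (by omega)
  have := hli.fintype_card_le_finrank
  simp [hfr] at this

end AlmostContactRiemannian

/-! ### Brackets and the anchor as derivations. -/

namespace LieAlgebroid

variable (A : LieAlgebroid n F E) (S : AlmostContactRiemannian n F E)

theorem bracket_skew (s t : SmoothSec n F E) : A.bracket s t = -A.bracket t s := by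
  have h := A.bracket_self (s + t)
  simp only [map_add, LinearMap.add_apply, A.bracket_self, zero_add, add_zero] at h
  exact eq_neg_of_add_eq_zero_right h

theorem bracket_bracket (s t u : SmoothSec n F E) :
    A.bracket (A.bracket s t) u = A.bracket s (A.bracket t u) - A.bracket t (A.bracket s u) := by
  have h := A.jacobi s t u
  rw [A.bracket_skew u s, A.bracket_skew u (A.bracket s t), map_neg] at h
  rw [← sub_eq_add_neg, ← sub_eq_add_neg, sub_eq_zero] at h
  exact h.symm

theorem bracket_funSMul_left (f : C^∞⟮𝓡 n, M; ℝ⟯) (s t : SmoothSec n F E) (x : M) :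
    A.bracket (funSMul f s) t x = f x • A.bracket s t x - A.deriv t f x • s x := by
  rw [A.bracket_skew, SmoothSec.neg_apply, A.leibniz, A.bracket_skew s t, SmoothSec.neg_apply, smul_neg, neg_add,
    sub_eq_add_neg]
  rfl

/-- The Leibniz rule for `f ξ`, paired with `η`. It shows that `ρ(s)(f)` is smooth and linear in
`f`. -/
theorem deriv_eq (s : SmoothSec n F E) (f : C^∞⟮𝓡 n, M; ℝ⟯) (x : M) :
    A.deriv s f x =
      S.η x (A.bracket s (funSMul f S.ξ) x) - f x * S.η x (A.bracket s S.ξ x) := by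
  rw [A.leibniz, map_add, map_smul, map_smul, S.η_ξ]
  simp [LieAlgebroid.deriv]

/-- The derivation of `C^∞(M)` along the anchor of a section, as a linear map. -/
def derivMap (s : SmoothSec n F E) : C^∞⟮𝓡 n, M; ℝ⟯ →ₗ[ℝ] C^∞⟮𝓡 n, M; ℝ⟯ where
  toFun f := pairing S.η (A.bracket s (funSMul f S.ξ)) - f * pairing S.η (A.bracket s S.ξ)
  map_add' f h := by
    ext x
    simp [add_funSMul]
    ring
  map_smul' c f := by
    ext x
    simp [smul_funSMul]
    ring

theorem derivMap_apply (s : SmoothSec n F E) (f : C^∞⟮𝓡 n, M; ℝ⟯) (x : M) :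
    A.derivMap S s f x = A.deriv s f x := (A.deriv_eq S s f x).symm

theorem bracket_funSMul (s t : SmoothSec n F E) (f : C^∞⟮𝓡 n, M; ℝ⟯) :
    A.bracket s (funSMul f t) = funSMul f (A.bracket s t) + funSMul (A.derivMap S s f) t := by
  ext x
  rw [A.leibniz, SmoothSec.add_apply, funSMul_apply, funSMul_apply, A.derivMap_apply]
  rfl

/-- The anchor is a morphism of Lie algebras. -/
theorem derivMap_bracket (s t : SmoothSec n F E) (f : C^∞⟮𝓡 n, M; ℝ⟯) :
    A.derivMap S (A.bracket s t) f =
      A.derivMap S s (A.derivMap S t f) - A.derivMap S t (A.derivMap S s f) := by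
  -- Pair Jacobi for `s, t, f ξ` with `η` and subtract `f` times Jacobi for `s, t, ξ`.
  have h := A.bracket_bracket s t (funSMul f S.ξ)
  simp only [A.bracket_funSMul S, map_add] at h
  have h0 := A.bracket_bracket s t S.ξ
  ext x
  have hx := congrArg (fun u : SmoothSec n F E => S.η x (u x)) h
  have h0x := congrArg (fun u : SmoothSec n F E => S.η x (u x)) h0
  simp [S.η_ξ] at hx h0x
  simp
  linear_combination hx - f x * h0x

theorem derivMap_one (s : SmoothSec n F E) : A.derivMap S s 1 = 0 := by
  have h : funSMul (1 : C^∞⟮𝓡 n, M; ℝ⟯) S.ξ = S.ξ := by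
    ext x
    simp
  ext x
  simp [derivMap, h]

/-! ### Invariance under the Reeb section. -/

variable {A S}

/-- An identity of smooth functions, so that derivations can be applied to it. -/
theorem IsContactRiemannian.two_smul_inner (h : A.IsContactRiemannian S)
    (s t : SmoothSec n F E) :
    (2 : ℝ) • inner S.g s (applyEnd S.Φ t) = A.derivMap S s (pairing S.η t)
      - A.derivMap S t (pairing S.η s) - pairing S.η (A.bracket s t) := by
  ext x
  have hx := h.2 s t x
  simp [derivMap_apply]
  rw [← hx, extDeriv]
  change _ = A.deriv s (fun y => S.η y (t y)) x - A.deriv t (fun y => S.η y (s y)) x - _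
  ring

/-- This is `dη(ξ, ·) = 0`, due to `Φ ξ = 0`, with `η(ξ)` constant. -/
theorem IsContactRiemannian.pairing_bracket_ξ (h : A.IsContactRiemannian S)
    (s : SmoothSec n F E) :
    pairing S.η (A.bracket S.ξ s) = A.derivMap S S.ξ (pairing S.η s) := by
  have h1 := h.two_smul_inner S.ξ s
  have h2 : pairing S.η S.ξ = 1 := by
    ext x
    exact S.η_ξ x
  have h3 : inner S.g S.ξ (applyEnd S.Φ s) = 0 := by
    ext x
    simp [S.inner_Φ_right, S.Φ_ξ]
  rw [h2, h3, smul_zero, derivMap_one, sub_zero] at h1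
  exact (sub_eq_zero.1 h1.symm).symm

/-- The Reeb section preserves the fundamental `2`-form. -/
theorem IsContactRiemannian.derivMap_ξ_inner (h : A.IsContactRiemannian S)
    (s t : SmoothSec n F E) :
    A.derivMap S S.ξ (inner S.g s (applyEnd S.Φ t)) =
      inner S.g (A.bracket S.ξ s) (applyEnd S.Φ t)
        + inner S.g s (applyEnd S.Φ (A.bracket S.ξ t)) := by
  -- `L_ξ` commutes with `d` by Jacobi and `derivMap_bracket`, and `L_ξ η = 0`.
  have h0 := congrArg (A.derivMap S S.ξ) (h.two_smul_inner s t)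
  have h1 := h.two_smul_inner (A.bracket S.ξ s) t
  have h2 := h.two_smul_inner s (A.bracket S.ξ t)
  have h3 : A.bracket S.ξ (A.bracket s t) =
      A.bracket (A.bracket S.ξ s) t + A.bracket s (A.bracket S.ξ t) := by
    rw [A.bracket_bracket S.ξ s t, sub_add_cancel]
  have h4 := h.pairing_bracket_ξ (A.bracket s t)
  have h5 : pairing S.η (A.bracket (A.bracket S.ξ s) t + A.bracket s (A.bracket S.ξ t)) =
      pairing S.η (A.bracket (A.bracket S.ξ s) t)
        + pairing S.η (A.bracket s (A.bracket S.ξ t)) := by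
    ext x
    simp
  rw [h3, h5] at h4
  simp only [map_sub, map_smul, derivMap_bracket, h.pairing_bracket_ξ] at h0 h1 h2
  rw [← h4] at h0
  have h6 : (2 : ℝ) • A.derivMap S S.ξ (inner S.g s (applyEnd S.Φ t)) = (2 : ℝ) •
      (inner S.g (A.bracket S.ξ s) (applyEnd S.Φ t)
        + inner S.g s (applyEnd S.Φ (A.bracket S.ξ t))) := by
    rw [smul_add, h0, h1, h2]
    abel
  exact smul_right_injective _ (two_ne_zero (α := ℝ)) h6

/-- On a `K`-contact Lie algebroid the Reeb section preserves the structure endomorphism. -/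
theorem IsKContact.bracket_ξ_applyEnd (h : A.IsKContact S) (t : SmoothSec n F E) :
    A.bracket S.ξ (applyEnd S.Φ t) = applyEnd S.Φ (A.bracket S.ξ t) := by
  ext x
  set w := A.bracket S.ξ (applyEnd S.Φ t) - applyEnd S.Φ (A.bracket S.ξ t) with hw
  -- Subtracting `L_ξ dη = 0` on `(w, t)` from `L_ξ g = 0` on `(w, Φ t)` leaves `g(w, w) = 0`.
  have h1 := h.2 w (applyEnd S.Φ t) x
  have h2 := congrArg (fun f : C^∞⟮𝓡 n, M; ℝ⟯ => f x) (h.1.derivMap_ξ_inner w t)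
  simp only [derivMap_apply] at h2
  change A.deriv S.ξ (inner S.g w (applyEnd S.Φ t)) x - _ - _ = _ at h1
  rw [h2] at h1
  have h3 : S.g.inner x (w x) (w x) = 0 := by
    have h4 : w x = A.bracket S.ξ (applyEnd S.Φ t) x - S.Φ x (A.bracket S.ξ t x) := rfl
    nth_rewrite 2 [h4]
    simp only [ContMDiffMap.coe_add, Pi.add_apply, inner_apply, applyEnd_apply] at h1
    rw [map_sub]
    linarith
  exact sub_eq_zero.1 (S.inner_self_eq_zero x h3)

/-! ### The normality tensor. -/

variable (A S)

/-- The tensor `N_Φ + 2 dη ⊗ ξ`, with `dη` replaced by the fundamental `2`-form. -/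
def normality (s t : SmoothSec n F E) : SmoothSec n F E :=
  A.nijenhuis S.Φ s t + funSMul ((2 : ℝ) • inner S.g s (applyEnd S.Φ t)) S.ξ

theorem normality_apply (s t : SmoothSec n F E) (x : M) :
    A.normality S s t x = A.bracket (applyEnd S.Φ s) (applyEnd S.Φ t) x
      - S.Φ x (A.bracket (applyEnd S.Φ s) t x) - S.Φ x (A.bracket s (applyEnd S.Φ t) x)
      + S.Φ x (S.Φ x (A.bracket s t x))
      + (2 * S.g.inner x (s x) (S.Φ x (t x))) • S.ξ x := rfl

theorem normality_skew (s t : SmoothSec n F E) (x : M) :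
    A.normality S s t x = -A.normality S t s x := by
  rw [normality_apply, normality_apply, A.bracket_skew (applyEnd S.Φ s) (applyEnd S.Φ t),
    A.bracket_skew s t, A.bracket_skew s, A.bracket_skew _ t, S.inner_Φ_right,
    S.g.symm x (S.Φ x (s x))]
  simp only [SmoothSec.neg_apply, map_neg]
  module

theorem normality_add (s t u : SmoothSec n F E) (x : M) :
    A.normality S (s + t) u x = A.normality S s u x + A.normality S t u x := by
  have h : applyEnd S.Φ (s + t) = applyEnd S.Φ s + applyEnd S.Φ t := by
    ext x
    exact (S.Φ x).map_add _ _
  simp only [normality_apply, h, map_add, LinearMap.add_apply, SmoothSec.add_apply,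
    _root_.add_apply]
  module

/-- The terms `ρ(Φ t)(f) Φ s` and `ρ(t)(f) Φ² s` each occur twice, with opposite signs. -/
theorem normality_funSMul (f : C^∞⟮𝓡 n, M; ℝ⟯) (s t : SmoothSec n F E) (x : M) :
    A.normality S (funSMul f s) t x = f x • A.normality S s t x := by
  simp only [normality_apply, applyEnd_funSMul, bracket_funSMul_left, map_sub, map_smul,
    funSMul_apply, applyEnd_apply, smul_apply, smul_eq_mul]
  module

variable {A S}

theorem IsKContact.normality_ξ (h : A.IsKContact S) (t : SmoothSec n F E) (x : M) :
    A.normality S S.ξ t x = 0 := by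
  have h0 : applyEnd S.Φ S.ξ = 0 := by
    ext x
    exact S.Φ_ξ x
  rw [normality_apply, h0, h.bracket_ξ_applyEnd, S.inner_Φ_right, S.Φ_ξ]
  simp

/-- As `Φ² u = -u`, `N_Φ(u, Φ u) = [u, Φ u] + Φ² [u, Φ u] = η([u, Φ u]) ξ`, which equals `-2 dη(u, Φ
u) ξ` because `η` kills `u` and `Φ u`. -/
theorem IsContactRiemannian.normality_applyEnd (h : A.IsContactRiemannian S)
    {u : SmoothSec n F E} (hu : ∀ x, S.η x (u x) = 0) (x : M) :
    A.normality S u (applyEnd S.Φ u) x = 0 := by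
  have h0 : applyEnd S.Φ (applyEnd S.Φ u) = -u := by
    ext x
    simp [S.Φ_sq, hu]
  have h1 := congrArg (fun f : C^∞⟮𝓡 n, M; ℝ⟯ => f x) (h.two_smul_inner u (applyEnd S.Φ u))
  have h2 : pairing S.η u = 0 := by
    ext x
    exact hu x
  have h3 : pairing S.η (applyEnd S.Φ u) = 0 := by
    ext x
    exact S.η_Φ x _
  rw [h2, h3, map_zero, map_zero] at h1
  simp at h1
  rw [normality_apply, h0, A.bracket_skew (applyEnd S.Φ u) (-u), A.bracket_self, S.Φ_sq]
  simp only [map_neg, LinearMap.neg_apply, neg_neg, A.bracket_self, SmoothSec.zero_apply, map_zero, neg_zero,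
    sub_zero, applyEnd_apply]
  rw [h1]
  module

/-- A contact Riemannian Lie algebroid of rank `3` has a horizontal section that
does not vanish at a given point. -/
theorem IsContactRiemannian.exists_horizontal (hrank : Module.finrank ℝ F = 3)
    (h : A.IsContactRiemannian S) (x : M) :
    ∃ u : SmoothSec n F E, (∀ y, S.η y (u y) = 0) ∧ u x ≠ 0 := by
  obtain ⟨⟨m, hm, hw⟩, hd⟩ := h
  obtain ⟨s, hs⟩ := hw x
  obtain ⟨σ, -, hσ⟩ := Finset.exists_ne_zero_of_sum_ne_zero hs
  have hm0 : 0 < m := by omega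
  -- Some factor `dη(a, b) = g(a, Φ b)` is nonzero at `x`; then `Φ b` is the required section.
  have h1 := Finset.prod_ne_zero_iff.1 (right_ne_zero_of_mul (right_ne_zero_of_mul hσ))
    ⟨0, hm0⟩ (Finset.mem_univ _)
  rw [hd] at h1
  refine ⟨applyEnd S.Φ (s (σ ⟨2 * 0 + 2, by omega⟩)), fun y => S.η_Φ y _, fun h0 => h1 ?_⟩
  exact (congrArg _ h0).trans (map_zero _)

theorem IsKContact.isNormal (hrank : Module.finrank ℝ F = 3) (h : A.IsKContact S) :
    A.IsNormal S := by
  intro s t x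
  rw [h.1.2]
  change A.normality S s t x = 0
  obtain ⟨u, hu, hux⟩ := h.1.exists_horizontal hrank x
  have hne : S.g.inner x (u x) (u x) ≠ 0 := (S.g.pos x _ hux).ne'
  have hdec : ∀ v : SmoothSec n F E, funSMul (inner S.g u u) v =
      funSMul (inner S.g u v) u + funSMul (inner S.g (applyEnd S.Φ u) v) (applyEnd S.Φ u)
        + funSMul (inner S.g u u * pairing S.η v) S.ξ := by
    intro v
    ext y
    exact S.inner_self_smul_eq y hrank (hu y) (v y)
  have hexp : ∀ v w : SmoothSec n F E, S.g.inner x (u x) (u x) • A.normality S v w x =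
      S.g.inner x (u x) (v x) • A.normality S u w x
        + S.g.inner x (S.Φ x (u x)) (v x) • A.normality S (applyEnd S.Φ u) w x := by
    intro v w
    rw [← inner_apply, ← normality_funSMul, hdec, normality_add, normality_add,
      normality_funSMul, normality_funSMul, normality_funSMul, h.normality_ξ, smul_zero, add_zero]
    rfl
  have huu : ∀ v : SmoothSec n F E, A.normality S v v x = 0 := fun v =>
    (smul_eq_zero.1 ((two_smul ℝ _).trans (eq_neg_iff_add_eq_zero.1
      (A.normality_skew S v v x)))).resolve_left two_ne_zero
  have huΦ := h.1.normality_applyEnd hu x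
  -- Expanding `w` in the first slot of `N(w, u)` leaves only `N(u, u)` and `N(Φ u, u)`.
  have hu0 : ∀ w, A.normality S u w x = 0 := by
    intro w
    have hw := hexp w u
    rw [huu, A.normality_skew S (applyEnd S.Φ u) u, huΦ, neg_zero, smul_zero, smul_zero,
      add_zero] at hw
    rw [A.normality_skew, (smul_eq_zero.1 hw).resolve_left hne, neg_zero]
  have hΦ0 : ∀ w, A.normality S (applyEnd S.Φ u) w x = 0 := by
    intro w
    have hw := hexp w (applyEnd S.Φ u)
    rw [huu, huΦ, smul_zero, smul_zero, add_zero] at hw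
    rw [A.normality_skew, (smul_eq_zero.1 hw).resolve_left hne, neg_zero]
  have hst := hexp s t
  rw [hu0, hΦ0, smul_zero, smul_zero, add_zero] at hst
  exact (smul_eq_zero.1 hst).resolve_left hne

end LieAlgebroid

end

theorem proposition4p9 {n : ℕ} {M : Type*} [TopologicalSpace M] [T2Space M] [ParacompactSpace M]
    [ChartedSpace (EuclideanSpace ℝ (Fin n)) M] [IsManifold (𝓡 n) ∞ M]
    {F : Type*} [NormedAddCommGroup F] [NormedSpace ℝ F]
    {E : M → Type*} [TopologicalSpace (Bundle.TotalSpace F E)]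
    [∀ x, AddCommGroup (E x)] [∀ x, Module ℝ (E x)] [∀ x, TopologicalSpace (E x)]
    [∀ x, IsTopologicalAddGroup (E x)] [∀ x, ContinuousSMul ℝ (E x)]
    [FiberBundle F E] [VectorBundle ℝ F E] [ContMDiffVectorBundle ∞ F E (𝓡 n)]
    (hrank : Module.finrank ℝ F = 3)
    (A : LieAlgebroid n F E) (S : AlmostContactRiemannian n F E)
    (hK : A.IsKContact S) : A.IsSasakian S :=
  ⟨hK.1, hK.isNormal hrank⟩
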